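/- Let $d\ge 2$, let $X_1,X_2,\dots$ be random vectors in $\mathbb{R}^d$ on a probability space, and let $\mathcal F_t=\sigma(X_1,\dots,X_t)$ (with $\mathcal F_0$ trivial). Suppose that there is $B>0$ with $\|X_t\|\le B$ almost surely for all $t\ge 1$ (Euclidean norm), and that the conditional mean is constant: $\mathbb{E}[X_t\mid\mathcal F_{t-1}]=\mu$ almost surely for all $t\ge 1$. Let $\psi_E(\lambda)=|\log(1-\lambda)+\lambda|$ for $\lambda\in[0,1)$, let $\bar\mu_t=\frac1t\sum_{i\le t}X_i$ for $t\ge1$, and $\bar\mu_0=0$. Let $\alpha\in(0,1)$. (1) Let $(\lambda_t)_{t\ge 1}$ be a predictable sequence with values in $(0,1)$, i.e. $\lambda_t$ is $\mathcal F_{t-1}$-measurable for each $t\ge 1$. Then, with probability at least $1-\alpha$, simultaneously for all $t\ge 1$, $$\left\|\frac{\sum_{i\le t}\lambda_iX_i}{\sum_{i\le t}\lambda_i}-\mu\right\|\le\frac{\frac{\sqrt d}{2B}\sum_{i\le t}\psi_E(\lambda_i)\,\|X_i-\bar\mu_{i-1}\|^2+4B\sqrt d+2B\sqrt d\,\log\frac1\alpha}{\frac23\sum_{i\le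 t}\lambda_i}.$$ (2) (Fixed-time confidence interval.) Let $n\ge 1$ be fixed and let $\lambda_1,\dots,\lambda_n$ be $(0,1)$-valued random variables, possibly chosen depending on $n$, such that $\lambda_i$ is $\mathcal F_{i-1}$-measurable for each $i\le n$. Then, with probability at least $1-\alpha$, the inequality displayed in (1) holds for $t=n$. -/

import Mathlib

open MeasureTheory

noncomputable section

namespace EmpBern

variable {Ω : Type*} {d : ℕ}

/-- The filtration generated by the observations `X 1, X 2, …` (the value `X 0` plays no role):
`ℱ t` is the σ-algebra generated by `X 1, …, X t`; in particular `ℱ 0` is trivial. -/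
def obsFiltration [mΩ : MeasurableSpace Ω] (X : ℕ → Ω → EuclideanSpace ℝ (Fin d))
    (hX : ∀ t, 1 ≤ t → Measurable (X t)) : Filtration ℕ mΩ where
  seq t := ⨆ i ∈ Finset.Icc 1 t,
    MeasurableSpace.comap (X i) (inferInstance : MeasurableSpace (EuclideanSpace ℝ (Fin d)))
  mono' := fun _ _ hst =>
    biSup_mono fun _ hi => Finset.Icc_subset_Icc_right hst hi
  le' := fun _ => iSup₂_le fun i hi => (hX i (Finset.mem_Icc.mp hi).1).comap_le

/-- `ψ_E(l) = |log (1 - l) + l|`, used for `l ∈ [0, 1)`. -/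
def psiE (l : ℝ) : ℝ := |Real.log (1 - l) + l|

/-- Empirical mean of `X 1, …, X t` at the sample point `ω`; it is `0` for `t = 0`. -/
def empMean (X : ℕ → Ω → EuclideanSpace ℝ (Fin d)) (t : ℕ) (ω : Ω) : EuclideanSpace ℝ (Fin d) :=
  (t : ℝ)⁻¹ • ∑ i ∈ Finset.Icc 1 t, X i ω

/-- Weighted mean `(∑_{i ≤ t} lam_i X_i) / (∑_{i ≤ t} lam_i)`. -/
def weightedMean (X : ℕ → Ω → EuclideanSpace ℝ (Fin d)) (lam : ℕ → Ω → ℝ) (t : ℕ) (ω : Ω) :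
    EuclideanSpace ℝ (Fin d) :=
  (∑ i ∈ Finset.Icc 1 t, lam i ω)⁻¹ • ∑ i ∈ Finset.Icc 1 t, lam i ω • X i ω

/-- The empirical-Bernstein radius at time `t`. -/
def ebRadius (B α : ℝ) (X : ℕ → Ω → EuclideanSpace ℝ (Fin d)) (lam : ℕ → Ω → ℝ)
    (t : ℕ) (ω : Ω) : ℝ :=
  (√(d : ℝ) / (2 * B) * ∑ i ∈ Finset.Icc 1 t, psiE (lam i ω) * ‖X i ω - empMean X (i - 1) ω‖ ^ 2
      + 4 * B * √(d : ℝ) + 2 * B * √(d : ℝ) * Real.log (1 / α))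
    / (2 / 3 * ∑ i ∈ Finset.Icc 1 t, lam i ω)

end EmpBern

end

namespace EmpBern

/-! ### Fan's inequality and convexity of `cosh ∘ √` -/

section Inequalities

/-! Put `c = 1 / (2B)` and `S_t = ∑ λ_i (X_i - μ)`. For each coordinate `j` and sign `±`, Fan's
inequality makes `exp (∑ (±c λ_i (X_i - μ)_j - ψ_E(λ_i) c² (X_i - μ̄_{i-1})_j²))` a supermartingale
started at `1` (`supermartingale_coordProcess`), and so is the average of these `2d` processes.

Bounding each squared coordinate residual by the full squared norm makes the penalty common to all
of them. The two signs then combine to `cosh (c S_j)`, and convexity of `cosh ∘ √` bounds the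
average over `j` below by `cosh (c ‖S_t‖ / √d)` (`cosh_mul_exp_le_mixProcess`). Ville's inequality
keeps the mixture below `1/α` for all times with probability at least `1 - α`, and on that event
solving for `‖S_t‖` yields the radius (`norm_weightedMean_sub_le`). -/

lemma psiE_eq {l : ℝ} (h1 : l < 1) : psiE l = -Real.log (1 - l) - l := by
  have h : Real.log (1 - l) ≤ (1 - l) - 1 := Real.log_le_sub_one_of_pos (by linarith)
  rw [psiE, abs_of_nonpos (by linarith)]
  ring

lemma psiE_nonneg (l : ℝ) : 0 ≤ psiE l := abs_nonneg _

lemma measurable_psiE : Measurable psiE := by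
  unfold psiE
  fun_prop

lemma hasSum_neg_log_one_sub_sub {y : ℝ} (h : |y| < 1) :
    HasSum (fun n : ℕ => y ^ (n + 2) / ((n : ℝ) + 2)) (-Real.log (1 - y) - y) := by
  have := (hasSum_nat_add_iff' (f := fun n : ℕ => y ^ (n + 1) / ((n : ℝ) + 1)) 1).mpr
    (Real.hasSum_pow_div_log_of_abs_lt_one h)
  convert! this using 1
  · ext n
    push_cast
    ring_nf
  · simp

/-- The inequality of Fan, in the range `|x| ≤ 1`. -/
lemma exp_sub_psiE_le {l x : ℝ} (h0 : 0 ≤ l) (h1 : l < 1) (hx : |x| ≤ 1) :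
    Real.exp (l * x - psiE l * x ^ 2) ≤ 1 + l * x := by
  have hx' := abs_le.mp hx
  have hpos : 0 < 1 + l * x := by nlinarith
  have hlx : |-(l * x)| ≤ l := by
    rw [abs_neg, abs_mul, abs_of_nonneg h0]
    exact mul_le_of_le_one_right h0 hx
  have hs1 := hasSum_neg_log_one_sub_sub (hlx.trans_lt h1)
  have hs2 := (hasSum_neg_log_one_sub_sub (y := l) (by rwa [abs_of_nonneg h0])).mul_right (x ^ 2)
  -- After taking logarithms, compare the series of `-log (1 - y) - y` at `y = -l x` with `x²` times
  -- the one at `y = l`. Every exponent is at least `2`, so `|x| ≤ 1` gives the termwise bound.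
  have hle := hasSum_le (fun n => ?_) hs1 hs2
  · rw [← Real.le_log_iff_exp_le hpos, psiE_eq h1]
    rw [sub_neg_eq_add, sub_neg_eq_add] at hle
    linarith
  · have hn : (0 : ℝ) < (n : ℝ) + 2 := by positivity
    rw [div_mul_eq_mul_div]
    refine div_le_div_of_nonneg_right ?_ hn.le
    calc (-(l * x)) ^ (n + 2) ≤ |(-(l * x)) ^ (n + 2)| := le_abs_self _
      _ = l ^ (n + 2) * |x| ^ (n + 2) := by
        rw [abs_pow, abs_neg, abs_mul, abs_of_nonneg h0, mul_pow]
      _ ≤ l ^ (n + 2) * x ^ 2 := by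
        rw [← sq_abs x]
        exact mul_le_mul_of_nonneg_left (pow_le_pow_of_le_one (abs_nonneg _) hx (by omega))
          (by positivity)

/-- `cosh` composed with the square root is convex, as a Jensen inequality for uniform weights. -/
lemma card_mul_cosh_le_sum_cosh {d : ℕ} (hd : 0 < d) (s : Fin d → ℝ) {x : ℝ}
    (hx : (d : ℝ) * x ^ 2 = ∑ j, s j ^ 2) : (d : ℝ) * Real.cosh x ≤ ∑ j, Real.cosh (s j) := by
  have hd' : (0 : ℝ) < d := by exact_mod_cast hd
  refine hasSum_le (fun n => ?_) ((Real.hasSum_cosh x).mul_left (d : ℝ))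
    (hasSum_sum fun j (_ : j ∈ Finset.univ) => Real.hasSum_cosh (s j))
  -- The `cosh` series has nonnegative coefficients in `x²`, and `x²` is the mean of the `s j ^ 2`,
  -- so the power-mean inequality applies term by term.
  have hmean := Real.pow_arith_mean_le_arith_mean_pow Finset.univ (fun _ : Fin d => (d : ℝ)⁻¹)
    (fun j => s j ^ 2) (fun _ _ => by positivity) (by simp [hd'.ne']) (fun _ _ => sq_nonneg _) n
  rw [← Finset.mul_sum, ← Finset.mul_sum, ← hx, inv_mul_cancel_left₀ hd'.ne'] at hmean
  simp_rw [← pow_mul] at hmean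
  rw [← Finset.sum_div, ← mul_div_assoc]
  refine div_le_div_of_nonneg_right ?_ (by positivity)
  rwa [inv_mul_eq_div, le_div_iff₀' hd'] at hmean

end Inequalities

/-! ### Maximal inequality for nonnegative supermartingales -/

section Ville

variable {Ω : Type*} {m0 : MeasurableSpace Ω} {P : Measure Ω} {𝒢 : Filtration ℕ m0}

/-- Optional stopping at the first time the level `c` is reached, followed by Markov's inequality
for the stopped value. -/
lemma mul_measureReal_exists_le_le [IsFiniteMeasure P] {M : ℕ → Ω → ℝ}
    (hM : Supermartingale M 𝒢 P) (h0 : ∀ t ω, 0 ≤ M t ω) {c : ℝ} (hc : 0 < c) (n : ℕ) :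
    c * P.real {ω | ∃ t ≤ n, c ≤ M t ω} ≤ ∫ ω, M 0 ω ∂P := by
  -- `hittingBtwn` returns `n` when the level is not reached, so `τ` is bounded.
  set τ : Ω → ℕ∞ := fun ω => (hittingBtwn M (Set.Ici c) 0 n ω : ℕ) with hτdef
  have hτ : IsStoppingTime 𝒢 τ :=
    hM.stronglyAdapted.adapted.isStoppingTime_hittingBtwn measurableSet_Ici
  have hτn : ∀ ω, τ ω ≤ n := fun ω => by
    simp only [hτdef]
    exact_mod_cast hittingBtwn_le (u := M) (s := Set.Ici c) (n := 0) ω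
  have hneg : stoppedValue (-M) τ = -stoppedValue M τ := rfl
  have hint : Integrable (stoppedValue M τ) P := by
    simpa [hneg] using (hM.neg.integrable_stoppedValue hτ hτn).neg
  have hoptional := hM.neg.expected_stoppedValue_mono (isStoppingTime_const 𝒢 0) hτ
    (fun ω => zero_le (a := τ ω)) hτn
  have hzero : stoppedValue (-M) (fun _ => ((0 : ℕ) : ℕ∞)) = fun ω => -M 0 ω := rfl
  have hle : ∫ ω, stoppedValue M τ ω ∂P ≤ ∫ ω, M 0 ω ∂P := by
    have h1 : ∫ ω, -M 0 ω ∂P ≤ ∫ ω, -stoppedValue M τ ω ∂P := hoptional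
    rw [integral_neg, integral_neg] at h1
    linarith
  refine le_trans (le_trans ?_ (mul_meas_ge_le_integral_of_nonneg
    (Filter.Eventually.of_forall fun ω => h0 _ ω) hint c)) hle
  refine mul_le_mul_of_nonneg_left (measureReal_mono ?_) hc.le
  rintro ω ⟨t, ht, hct⟩
  exact stoppedValue_hittingBtwn_mem (s := Set.Ici c) ⟨t, ⟨Nat.zero_le t, ht⟩, hct⟩

/-- **Ville inequality** for nonnegative supermartingales. -/
lemma ville_inequality [IsFiniteMeasure P] {M : ℕ → Ω → ℝ}
    (hM : Supermartingale M 𝒢 P) (h0 : ∀ t ω, 0 ≤ M t ω) {c : ℝ} (hc : 0 < c) :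
    P.real {ω | ∃ t, c ≤ M t ω} ≤ (∫ ω, M 0 ω ∂P) / c := by
  have hU : {ω | ∃ t, c ≤ M t ω} = ⋃ n, {ω | ∃ t ≤ n, c ≤ M t ω} := by
    ext ω
    simp only [Set.mem_ofPred_eq, Set.mem_iUnion]
    exact ⟨fun ⟨t, ht⟩ => ⟨t, t, le_rfl, ht⟩, fun ⟨_, t, _, ht⟩ => ⟨t, ht⟩⟩
  have hmono : Monotone fun n => {ω | ∃ t ≤ n, c ≤ M t ω} :=
    fun n m hnm ω ⟨t, ht, h⟩ => ⟨t, ht.trans hnm, h⟩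
  have hlim := (ENNReal.tendsto_toReal (measure_ne_top P _)).comp
    (tendsto_measure_iUnion_atTop (μ := P) hmono)
  rw [← hU] at hlim
  refine le_of_tendsto' hlim fun n => ?_
  rw [le_div_iff₀' hc]
  exact mul_measureReal_exists_le_le hM h0 hc n

lemma supermartingale_finset_sum {ι : Type*} (s : Finset ι) {M : ι → ℕ → Ω → ℝ}
    [IsFiniteMeasure P] (hM : ∀ i ∈ s, Supermartingale (M i) 𝒢 P) :
    Supermartingale (∑ i ∈ s, M i) 𝒢 P := by
  classical
  induction s using Finset.induction_on with
  | empty => simpa using (martingale_zero ℝ 𝒢 P).supermartingale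
  | insert a s ha ih =>
    rw [Finset.sum_insert ha]
    exact (hM a (Finset.mem_insert_self _ _)).add
      (ih fun i hi => hM i (Finset.mem_insert_of_mem hi))

end Ville

/-! ### The scalar exponential supermartingale -/

section ExpProcess

variable {Ω : Type*} {m0 : MeasurableSpace Ω} {P : Measure Ω} {𝒢 : Filtration ℕ m0}

/-- The empirical-Bernstein exponential process of increments `Y`, weights `l` and
predictions `δ`. -/
noncomputable def expProcess (l Y δ : ℕ → Ω → ℝ) (t : ℕ) (ω : Ω) : ℝ :=
  Real.exp (∑ i ∈ Finset.Icc 1 t, (l i ω * Y i ω - psiE (l i ω) * (Y i ω - δ i ω) ^ 2))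

variable {l Y δ : ℕ → Ω → ℝ}

lemma expProcess_pos (t : ℕ) (ω : Ω) : 0 < expProcess l Y δ t ω := Real.exp_pos _

lemma expProcess_zero : expProcess l Y δ 0 = fun _ => 1 := by
  ext ω
  simp [expProcess]

lemma expProcess_succ (t : ℕ) (ω : Ω) : expProcess l Y δ (t + 1) ω =
    expProcess l Y δ t ω * Real.exp (l (t + 1) ω * Y (t + 1) ω -
      psiE (l (t + 1) ω) * (Y (t + 1) ω - δ (t + 1) ω) ^ 2) := by
  rw [expProcess, expProcess, Finset.sum_Icc_succ_top (by omega), Real.exp_add]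

lemma measurable_expProcess
    (hl : ∀ t, Measurable[𝒢 t] (l (t + 1))) (hδ : ∀ t, Measurable[𝒢 t] (δ (t + 1)))
    (hY : ∀ t, Measurable[𝒢 (t + 1)] (Y (t + 1))) (t : ℕ) :
    Measurable[𝒢 t] (expProcess l Y δ t) := by
  induction t with
  | zero => rw [expProcess_zero]; exact measurable_const
  | succ t ih =>
    have h1 := (hl t).mono (𝒢.mono t.le_succ) le_rfl
    have h2 := (hδ t).mono (𝒢.mono t.le_succ) le_rfl
    have h3 := ih.mono (𝒢.mono t.le_succ) le_rfl
    rw [funext (expProcess_succ (l := l) (Y := Y) (δ := δ) t)]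
    exact h3.mul (((h1.mul (hY t)).sub ((measurable_psiE.comp h1).mul
      (((hY t).sub h2).pow_const 2))).exp)

/-- The penalty is nonnegative and can be dropped, leaving at most `C` per step. This serves only
integrability. -/
lemma expProcess_le_exp {C : ℝ} {ω : Ω}
    (hl01 : ∀ t, l (t + 1) ω ∈ Set.Ioo (0 : ℝ) 1) (hC : ∀ t, |Y (t + 1) ω| ≤ C) (t : ℕ) :
    expProcess l Y δ t ω ≤ Real.exp C ^ t := by
  induction t with
  | zero => simp [expProcess_zero]
  | succ t ih =>
    rw [expProcess_succ, pow_succ]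
    refine mul_le_mul ih (Real.exp_le_exp.mpr ?_) (Real.exp_pos _).le
      (pow_pos (Real.exp_pos _) _).le
    have h1 : l (t + 1) ω * Y (t + 1) ω ≤ C :=
      calc l (t + 1) ω * Y (t + 1) ω ≤ |l (t + 1) ω * Y (t + 1) ω| := le_abs_self _
        _ = l (t + 1) ω * |Y (t + 1) ω| := by rw [abs_mul, abs_of_pos (hl01 t).1]
        _ ≤ |Y (t + 1) ω| := mul_le_of_le_one_left (abs_nonneg _) (hl01 t).2.le
        _ ≤ C := hC t
    have h2 := mul_nonneg (psiE_nonneg (l (t + 1) ω)) (sq_nonneg (Y (t + 1) ω - δ (t + 1) ω))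
    linarith

/-- With `a, y, b` the values of `l, Y, δ` at `t + 1`, Fan's inequality at `y - b` bounds the new
factor by `e^{ab} (1 + a (y - b))`. As `a` and `b` are predictable and `y` has conditional mean `0`,
the conditional mean of this bound is `e^{ab} (1 - ab) ≤ 1`. Hence the penalty may be centred at any
predictable `δ`, not only at the mean. -/
lemma supermartingale_expProcess [IsProbabilityMeasure P]
    (hl : ∀ t, Measurable[𝒢 t] (l (t + 1))) (hl01 : ∀ t ω, l (t + 1) ω ∈ Set.Ioo (0 : ℝ) 1)
    (hδ : ∀ t, Measurable[𝒢 t] (δ (t + 1))) (hY : ∀ t, Measurable[𝒢 (t + 1)] (Y (t + 1)))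
    {C : ℝ} (hC : ∀ t, ∀ᵐ ω ∂P, |Y (t + 1) ω| ≤ C)
    (hYδ : ∀ t, ∀ᵐ ω ∂P, |Y (t + 1) ω - δ (t + 1) ω| ≤ 1)
    (hmean : ∀ t, P[Y (t + 1) | 𝒢 t] =ᵐ[P] 0) :
    Supermartingale (expProcess l Y δ) 𝒢 P := by
  have hC0 : 0 ≤ C := by
    obtain ⟨ω, hω⟩ := (hC 0).exists
    exact (abs_nonneg _).trans hω
  have hmeas := measurable_expProcess hl hδ hY
  have hbd : ∀ t, ∀ᵐ ω ∂P, expProcess l Y δ t ω ≤ Real.exp C ^ t := fun t => by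
    filter_upwards [ae_all_iff.mpr hC] with ω hω
    exact expProcess_le_exp (fun t => hl01 t ω) hω t
  have hint : ∀ t, Integrable (expProcess l Y δ t) P := fun t => by
    refine Integrable.of_bound ((hmeas t).mono (𝒢.le t) le_rfl).aestronglyMeasurable
      (Real.exp C ^ t) ?_
    filter_upwards [hbd t] with ω hω
    rwa [Real.norm_of_nonneg (expProcess_pos t ω).le]
  refine supermartingale_nat (fun t => (hmeas t).stronglyMeasurable) hint fun t => ?_
  set N := expProcess l Y δ t with hN
  set a : Ω → ℝ := l (t + 1)
  set y : Ω → ℝ := Y (t + 1)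
  set b : Ω → ℝ := δ (t + 1)
  set E : Ω → ℝ := fun ω => N ω * Real.exp (a ω * b ω) with hE
  have hEm : Measurable[𝒢 t] E := (hmeas t).mul (((hl t).mul (hδ t)).exp)
  -- `U + V * y` is the upper bound from Fan's inequality, split into a `𝒢 t`-measurable part and a
  -- `𝒢 t`-measurable multiple of `y`.
  set U : Ω → ℝ := fun ω => E ω * (1 - a ω * b ω) with hU
  have hUm : Measurable[𝒢 t] U := hEm.mul (measurable_const.sub ((hl t).mul (hδ t)))
  set V : Ω → ℝ := fun ω => E ω * a ω with hV
  have hVm : Measurable[𝒢 t] V := hEm.mul (hl t)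
  have hab : ∀ᵐ ω ∂P, |a ω * b ω| ≤ C + 1 := by
    filter_upwards [hC t, hYδ t] with ω h1 h2
    have hb : |b ω| ≤ C + 1 := by
      calc |b ω| = |y ω - (y ω - b ω)| := by ring_nf
        _ ≤ |y ω| + |y ω - b ω| := abs_sub _ _
        _ ≤ C + 1 := add_le_add h1 h2
    rw [abs_mul, abs_of_pos (hl01 t ω).1]
    exact (mul_le_of_le_one_left (abs_nonneg _) (hl01 t ω).2.le).trans hb
  have hEbd : ∀ᵐ ω ∂P, |E ω| ≤ Real.exp C ^ t * Real.exp (C + 1) := by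
    filter_upwards [hbd t, hab] with ω h1 h2
    rw [hE, abs_of_pos (mul_pos (expProcess_pos t ω) (Real.exp_pos _))]
    exact mul_le_mul h1 (Real.exp_le_exp.mpr ((le_abs_self _).trans h2)) (Real.exp_pos _).le
      (by positivity)
  have hyint : Integrable y P :=
    Integrable.of_bound ((hY t).mono (𝒢.le _) le_rfl).aestronglyMeasurable C (hC t)
  have hUint : Integrable U P := by
    refine Integrable.of_bound (hUm.mono (𝒢.le t) le_rfl).aestronglyMeasurable
      (Real.exp C ^ t * Real.exp (C + 1) * (1 + (C + 1))) ?_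
    filter_upwards [hEbd, hab] with ω h1 h2
    rw [Real.norm_eq_abs, hU, abs_mul]
    refine mul_le_mul h1 ((abs_sub _ _).trans ?_) (abs_nonneg _) (by positivity)
    rw [abs_one]
    linarith
  have hVyint : Integrable (V * y) P := by
    refine hyint.bdd_mul (c := Real.exp C ^ t * Real.exp (C + 1))
      (hVm.mono (𝒢.le t) le_rfl).aestronglyMeasurable ?_
    filter_upwards [hEbd] with ω h1
    rw [Real.norm_eq_abs, hV, abs_mul, abs_of_pos (hl01 t ω).1]
    exact (mul_le_of_le_one_right (abs_nonneg _) (hl01 t ω).2.le).trans h1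
  have hstep : expProcess l Y δ (t + 1) ≤ᵐ[P] U + V * y := by
    filter_upwards [hYδ t] with ω h1
    have hfan := exp_sub_psiE_le (hl01 t ω).1.le (hl01 t ω).2 h1
    have hEpos : 0 < E ω := mul_pos (expProcess_pos t ω) (Real.exp_pos _)
    have hsplit : expProcess l Y δ (t + 1) ω =
        E ω * Real.exp (a ω * (y ω - b ω) - psiE (a ω) * (y ω - b ω) ^ 2) := by
      rw [expProcess_succ, hE, mul_assoc, ← Real.exp_add]
      congr 2
      ring
    rw [hsplit]
    refine (mul_le_mul_of_nonneg_left hfan hEpos.le).trans_eq ?_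
    simp only [Pi.add_apply, Pi.mul_apply, hU, hV]
    ring
  have hcond := condExp_mono (m := 𝒢 t) (hint (t + 1)) (hUint.add hVyint) hstep
  have hadd := condExp_add hUint hVyint (𝒢 t)
  have hUc := condExp_of_stronglyMeasurable (𝒢.le t) hUm.stronglyMeasurable hUint
  have hVc := condExp_mul_of_stronglyMeasurable_left hVm.stronglyMeasurable hVyint hyint
  filter_upwards [hcond, hadd, hVc, hmean t] with ω h1 h2 h3 h4
  refine h1.trans ?_
  rw [h2, Pi.add_apply, hUc, h3, Pi.mul_apply, h4]
  simp only [Pi.zero_apply, mul_zero, add_zero, hU, hE]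
  rw [mul_assoc]
  refine mul_le_of_le_one_right (expProcess_pos t ω).le ?_
  calc Real.exp (a ω * b ω) * (1 - a ω * b ω)
      ≤ Real.exp (a ω * b ω) * Real.exp (-(a ω * b ω)) :=
        mul_le_mul_of_nonneg_left (by linarith [Real.add_one_le_exp (-(a ω * b ω))])
          (Real.exp_pos _).le
    _ = 1 := by rw [← Real.exp_add, add_neg_cancel, Real.exp_zero]

end ExpProcess

/-! ### Coordinate processes, their mixture and the confidence radius -/

section Observations

variable {Ω : Type*} {d : ℕ} {X : ℕ → Ω → EuclideanSpace ℝ (Fin d)}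

lemma measurable_obs [MeasurableSpace Ω] (hX : ∀ t, 1 ≤ t → Measurable (X t))
    {i t : ℕ} (hi : 1 ≤ i) (hit : i ≤ t) :
    Measurable[obsFiltration X hX t] (X i) :=
  (comap_measurable (X i)).mono
    (le_iSup₂ (f := fun i (_ : i ∈ Finset.Icc 1 t) => MeasurableSpace.comap (X i)
      (inferInstance : MeasurableSpace (EuclideanSpace ℝ (Fin d)))) i
      (Finset.mem_Icc.mpr ⟨hi, hit⟩)) le_rfl

lemma measurable_empMean [MeasurableSpace Ω] (hX : ∀ t, 1 ≤ t → Measurable (X t)) (t : ℕ) :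
    Measurable[obsFiltration X hX t] (empMean X t) := by
  have hsum : Measurable[obsFiltration X hX t] fun ω => ∑ i ∈ Finset.Icc 1 t, X i ω :=
    Finset.measurable_fun_sum _ fun i hi =>
      measurable_obs hX (Finset.mem_Icc.mp hi).1 (Finset.mem_Icc.mp hi).2
  exact (measurable_const_smul (t : ℝ)⁻¹).comp hsum

lemma norm_empMean_le {B : ℝ} (hB : 0 ≤ B) {ω : Ω} (h : ∀ t, ‖X (t + 1) ω‖ ≤ B) (t : ℕ) :
    ‖empMean X t ω‖ ≤ B := by
  rcases Nat.eq_zero_or_pos t with rfl | ht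
  · simpa [empMean] using hB
  · have ht' : (0 : ℝ) < t := by exact_mod_cast ht
    rw [empMean, norm_smul, norm_inv, Real.norm_of_nonneg ht'.le, inv_mul_le_iff₀ ht']
    have hle := norm_sum_le_of_le (Finset.Icc 1 t) (f := fun i => X i ω) (n := fun _ => B)
      fun i hi => by
        obtain ⟨k, rfl⟩ := Nat.exists_eq_add_of_le' (Finset.mem_Icc.mp hi).1
        exact h k
    simpa using hle

/-- The exponential process of the `j`-th coordinate, scaled by `c`. -/
noncomputable def coordProcess (X : ℕ → Ω → EuclideanSpace ℝ (Fin d)) (lam : ℕ → Ω → ℝ)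
    (μ : EuclideanSpace ℝ (Fin d)) (c : ℝ) (j : Fin d) : ℕ → Ω → ℝ :=
  expProcess lam (fun i ω => c * (X i ω j - μ j)) fun i ω => c * (empMean X (i - 1) ω j - μ j)

/-- The centre `μ` cancels in the residual `c (X_t - μ̄_{t-1})_j`. Both vectors have norm at most
`B`, so `|c| * (2 * B) ≤ 1` is what Fan's inequality requires. -/
lemma supermartingale_coordProcess [MeasurableSpace Ω] {P : Measure Ω} [IsProbabilityMeasure P]
    (hX : ∀ t, 1 ≤ t → Measurable (X t)) {B : ℝ} (hB : 0 ≤ B)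
    (hXB : ∀ t, 1 ≤ t → ∀ᵐ ω ∂P, ‖X t ω‖ ≤ B) {μ : EuclideanSpace ℝ (Fin d)}
    (hμ : ∀ t, 1 ≤ t → P[X t | obsFiltration X hX (t - 1)] =ᵐ[P] fun _ => μ)
    {lam : ℕ → Ω → ℝ}
    (hlam : ∀ t, 1 ≤ t → Measurable[obsFiltration X hX (t - 1)] (lam t))
    (hlam01 : ∀ t, 1 ≤ t → ∀ ω, lam t ω ∈ Set.Ioo (0 : ℝ) 1) {c : ℝ} (hc : |c| * (2 * B) ≤ 1)
    (j : Fin d) : Supermartingale (coordProcess X lam μ c j) (obsFiltration X hX) P := by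
  have hproj : Measurable fun x : EuclideanSpace ℝ (Fin d) => x j :=
    (EuclideanSpace.proj (𝕜 := ℝ) j).continuous.measurable
  have hsucc : ∀ t : ℕ, 1 ≤ t + 1 := fun t => Nat.le_add_left 1 t
  refine supermartingale_expProcess (C := |c| * (B + ‖μ‖)) (fun t => hlam (t + 1) (hsucc t))
    (fun t => hlam01 (t + 1) (hsucc t))
    (fun t => ((hproj.comp (measurable_empMean hX t)).sub_const _).const_mul _)
    (fun t => ((hproj.comp (measurable_obs hX (hsucc t) le_rfl)).sub_const _).const_mul _)
    (fun t => ?_) (fun t => ?_) fun t => ?_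
  · filter_upwards [hXB (t + 1) (hsucc t)] with ω hω
    rw [abs_mul]
    refine mul_le_mul_of_nonneg_left ?_ (abs_nonneg c)
    exact (abs_sub _ _).trans
      (add_le_add ((PiLp.norm_apply_le (X (t + 1) ω) j).trans hω) (PiLp.norm_apply_le μ j))
  · filter_upwards [ae_all_iff.mpr fun t => hXB (t + 1) (hsucc t)] with ω hω
    have hmean := norm_empMean_le hB hω t
    rw [← mul_sub, sub_sub_sub_cancel_right, abs_mul]
    refine (mul_le_mul_of_nonneg_left ?_ (abs_nonneg c)).trans hc
    refine (abs_sub _ _).trans ?_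
    have h1 := (PiLp.norm_apply_le (X (t + 1) ω) j).trans (hω t)
    have h2 := (PiLp.norm_apply_le (empMean X t ω) j).trans hmean
    rw [Real.norm_eq_abs] at h1 h2
    rw [Nat.add_sub_cancel]
    linarith
  · have hint : Integrable (X (t + 1)) P :=
      Integrable.of_bound (hX (t + 1) (hsucc t)).aestronglyMeasurable B (hXB (t + 1) (hsucc t))
    -- Conditional expectation commutes with the affine map `x ↦ c * x j - c * μ j`, which vanishes
    -- at `μ`.
    have hcomm := ContinuousLinearMap.comp_condExp_add_const_comm
      ((obsFiltration X hX).le t) hint (c • EuclideanSpace.proj (𝕜 := ℝ) j) (-(c * μ j))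
    have heq : (fun ω => c * (X (t + 1) ω j - μ j)) = fun ω =>
        (c • EuclideanSpace.proj (𝕜 := ℝ) j : EuclideanSpace ℝ (Fin d) →L[ℝ] ℝ) (X (t + 1) ω)
          + -(c * μ j) := by
      ext ω
      change c * (X (t + 1) ω j - μ j) = c * X (t + 1) ω j + -(c * μ j)
      ring
    simp only [heq]
    refine hcomm.symm.trans ?_
    filter_upwards [hμ (t + 1) (hsucc t)] with ω hω
    rw [Nat.add_sub_cancel] at hω
    rw [hω]
    simp

/-- Replacing the coordinate residual by the full norm makes the penalty independent of `j` and of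
the sign of `c`, so that it factors out of the mixture. -/
lemma exp_le_coordProcess {lam : ℕ → Ω → ℝ} {μ : EuclideanSpace ℝ (Fin d)} (c : ℝ) (j : Fin d)
    (t : ℕ) (ω : Ω) :
    Real.exp (c * (∑ i ∈ Finset.Icc 1 t, lam i ω • (X i ω - μ)) j) *
      Real.exp (-(c ^ 2 * ∑ i ∈ Finset.Icc 1 t,
        psiE (lam i ω) * ‖X i ω - empMean X (i - 1) ω‖ ^ 2)) ≤ coordProcess X lam μ c j t ω := by
  rw [coordProcess, expProcess, ← Real.exp_add, Real.exp_le_exp, Finset.sum_sub_distrib,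
    sub_eq_add_neg]
  refine add_le_add (le_of_eq ?_) (neg_le_neg ?_)
  · rw [WithLp.ofLp_sum, Finset.sum_apply, Finset.mul_sum]
    refine Finset.sum_congr rfl fun i _ => ?_
    simp only [PiLp.smul_apply, PiLp.sub_apply, smul_eq_mul]
    ring
  · rw [Finset.mul_sum]
    refine Finset.sum_le_sum fun i _ => ?_
    have h : (X i ω j - empMean X (i - 1) ω j) ^ 2 ≤ ‖X i ω - empMean X (i - 1) ω‖ ^ 2 := by
      rw [← sq_abs]
      exact pow_le_pow_left₀ (abs_nonneg _)
        (PiLp.norm_apply_le (X i ω - empMean X (i - 1) ω) j) 2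
    calc psiE (lam i ω) * (c * (X i ω j - μ j) - c * (empMean X (i - 1) ω j - μ j)) ^ 2
        = c ^ 2 * (psiE (lam i ω) * (X i ω j - empMean X (i - 1) ω j) ^ 2) := by ring
      _ ≤ _ := mul_le_mul_of_nonneg_left (mul_le_mul_of_nonneg_left h (psiE_nonneg _))
        (sq_nonneg c)

/-- The uniform mixture of the coordinate processes with scales `±c`. -/
noncomputable def mixProcess (X : ℕ → Ω → EuclideanSpace ℝ (Fin d)) (lam : ℕ → Ω → ℝ)
    (μ : EuclideanSpace ℝ (Fin d)) (c : ℝ) : ℕ → Ω → ℝ :=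
  (2 * (d : ℝ))⁻¹ • ∑ j, (coordProcess X lam μ c j + coordProcess X lam μ (-c) j)

lemma mixProcess_apply (lam : ℕ → Ω → ℝ) (μ : EuclideanSpace ℝ (Fin d)) (c : ℝ) (t : ℕ) (ω : Ω) :
    mixProcess X lam μ c t ω = (2 * (d : ℝ))⁻¹ *
      ∑ j, (coordProcess X lam μ c j t ω + coordProcess X lam μ (-c) j t ω) := by
  simp [mixProcess, Finset.sum_apply]

/-- The scales `±c` pair up to `2 cosh (c S_j)`. Since `‖S‖² / d` is the mean of the `S_j²`,
`card_mul_cosh_le_sum_cosh` passes from coordinates to the norm; the factor `√d` of the radius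
arises here. -/
lemma cosh_mul_exp_le_mixProcess (hd : 0 < d) (lam : ℕ → Ω → ℝ) (μ : EuclideanSpace ℝ (Fin d))
    (c : ℝ) (t : ℕ) (ω : Ω) :
    Real.cosh (c * ‖∑ i ∈ Finset.Icc 1 t, lam i ω • (X i ω - μ)‖ / √(d : ℝ)) *
      Real.exp (-(c ^ 2 * ∑ i ∈ Finset.Icc 1 t,
        psiE (lam i ω) * ‖X i ω - empMean X (i - 1) ω‖ ^ 2)) ≤ mixProcess X lam μ c t ω := by
  have hd' : (0 : ℝ) < d := by exact_mod_cast hd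
  set S := ∑ i ∈ Finset.Icc 1 t, lam i ω • (X i ω - μ)
  set E := Real.exp (-(c ^ 2 * ∑ i ∈ Finset.Icc 1 t,
        psiE (lam i ω) * ‖X i ω - empMean X (i - 1) ω‖ ^ 2))
  have hcosh := card_mul_cosh_le_sum_cosh hd (fun j => c * S j) (x := c * ‖S‖ / √(d : ℝ)) (by
    rw [div_pow, Real.sq_sqrt hd'.le, mul_div_cancel₀ _ hd'.ne', mul_pow,
      EuclideanSpace.real_norm_sq_eq, Finset.mul_sum]
    exact Finset.sum_congr rfl fun j _ => (mul_pow _ _ _).symm)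
  rw [mixProcess_apply, le_inv_mul_iff₀ (by positivity)]
  calc 2 * (d : ℝ) * (Real.cosh (c * ‖S‖ / √(d : ℝ)) * E)
      = 2 * E * (d * Real.cosh (c * ‖S‖ / √(d : ℝ))) := by ring
    _ ≤ 2 * E * ∑ j, Real.cosh (c * S j) := mul_le_mul_of_nonneg_left hcosh (by positivity)
    _ = ∑ j, (Real.exp (c * S j) * E + Real.exp (-c * S j) * E) := by
      rw [Finset.mul_sum]
      refine Finset.sum_congr rfl fun j _ => ?_
      rw [Real.cosh_eq, neg_mul]
      ring
    _ ≤ _ := Finset.sum_le_sum fun j _ => add_le_add (exp_le_coordProcess c j t ω) (by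
      have h := exp_le_coordProcess (X := X) (lam := lam) (μ := μ) (-c) j t ω
      rwa [neg_sq] at h)

lemma weightedMean_congr {lam lam' : ℕ → Ω → ℝ} {t : ℕ} {ω : Ω}
    (h : ∀ i ∈ Finset.Icc 1 t, lam i ω = lam' i ω) :
    weightedMean X lam t ω = weightedMean X lam' t ω := by
  rw [weightedMean, weightedMean, Finset.sum_congr rfl h]
  congr 1
  exact Finset.sum_congr rfl fun i hi => by rw [h i hi]

lemma ebRadius_congr {B α : ℝ} {lam lam' : ℕ → Ω → ℝ} {t : ℕ} {ω : Ω}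
    (h : ∀ i ∈ Finset.Icc 1 t, lam i ω = lam' i ω) :
    ebRadius B α X lam t ω = ebRadius B α X lam' t ω := by
  have h' : ∑ i ∈ Finset.Icc 1 t, psiE (lam i ω) * ‖X i ω - empMean X (i - 1) ω‖ ^ 2 =
      ∑ i ∈ Finset.Icc 1 t, psiE (lam' i ω) * ‖X i ω - empMean X (i - 1) ω‖ ^ 2 :=
    Finset.sum_congr rfl fun i hi => by rw [h i hi]
  rw [ebRadius, ebRadius, h', Finset.sum_congr rfl h]

/-- Deterministic inversion: for `x = ‖S‖ / (2B√d)`, the bound `cosh x ≥ e^x / 2 ≥ e^{x-1}` turns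
the hypothesis into a linear bound on `x`. -/
lemma norm_weightedMean_sub_le (hd : 0 < d) {B : ℝ} (hB : 0 < B) {α : ℝ}
    (hα : α ∈ Set.Ioo (0 : ℝ) 1) {lam : ℕ → Ω → ℝ} {μ : EuclideanSpace ℝ (Fin d)} {t : ℕ}
    {ω : Ω} (hL : 0 < ∑ i ∈ Finset.Icc 1 t, lam i ω)
    (h : mixProcess X lam μ (1 / (2 * B)) t ω < 1 / α) :
    ‖weightedMean X lam t ω - μ‖ ≤ ebRadius B α X lam t ω := by
  have hd' : (0 : ℝ) < √(d : ℝ) := Real.sqrt_pos.mpr (by exact_mod_cast hd)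
  have hmix := (cosh_mul_exp_le_mixProcess hd lam μ (1 / (2 * B)) t ω).trans_lt h
  rw [ebRadius]
  set S := ∑ i ∈ Finset.Icc 1 t, lam i ω • (X i ω - μ) with hS
  set V := ∑ i ∈ Finset.Icc 1 t, psiE (lam i ω) * ‖X i ω - empMean X (i - 1) ω‖ ^ 2
  set L := ∑ i ∈ Finset.Icc 1 t, lam i ω with hLdef
  have hdiff : weightedMean X lam t ω - μ = L⁻¹ • S := by
    rw [weightedMean, hS]
    simp_rw [smul_sub]
    rw [Finset.sum_sub_distrib, ← Finset.sum_smul, smul_sub, inv_smul_smul₀ hL.ne']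
  set x := 1 / (2 * B) * ‖S‖ / √(d : ℝ) with hx
  have hSx : ‖S‖ = 2 * B * √(d : ℝ) * x := by
    rw [hx]
    field_simp
  have hx0 : 0 ≤ x := by positivity
  have hexp : Real.exp (x - 1 - (1 / (2 * B)) ^ 2 * V) ≤ 1 / α := by
    refine le_trans ?_ hmix.le
    rw [sub_eq_add_neg (x - 1), Real.exp_add]
    refine mul_le_mul_of_nonneg_right ?_ (Real.exp_pos _).le
    rw [Real.exp_sub, Real.cosh_eq]
    have h2 : (2 : ℝ) ≤ Real.exp 1 := by linarith [Real.add_one_le_exp (1 : ℝ)]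
    calc Real.exp x / Real.exp 1 ≤ Real.exp x / 2 :=
          div_le_div_of_nonneg_left (Real.exp_pos _).le two_pos h2
      _ ≤ _ := by linarith [Real.exp_pos (-x)]
  have hlog := (Real.le_log_iff_exp_le (by have := hα.1; positivity)).mpr hexp
  rw [hdiff, norm_smul, norm_inv, Real.norm_of_nonneg hL.le, le_div_iff₀ (by positivity)]
  have hcancel : L⁻¹ * ‖S‖ * (2 / 3 * L) = 2 / 3 * ‖S‖ := by
    field_simp
  rw [hcancel, hSx]
  -- `hlog` gives the stronger bound with `x` on the left and `1` in place of `2`; the constants `2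
  -- / 3` and `4B√d` of the radius leave slack.
  have hkey : 2 / 3 * x ≤ (1 / (2 * B)) ^ 2 * V + 2 + Real.log (1 / α) := by linarith
  calc 2 / 3 * (2 * B * √(d : ℝ) * x) = 2 * B * √(d : ℝ) * (2 / 3 * x) := by ring
    _ ≤ 2 * B * √(d : ℝ) * ((1 / (2 * B)) ^ 2 * V + 2 + Real.log (1 / α)) :=
      mul_le_mul_of_nonneg_left hkey (by positivity)
    _ = _ := by
      field_simp
      ring

lemma one_sub_le_measureReal_forall [MeasurableSpace Ω] {P : Measure Ω} [IsProbabilityMeasure P]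
    (hd : 0 < d) (hX : ∀ t, 1 ≤ t → Measurable (X t)) {B : ℝ} (hB : 0 < B)
    (hXB : ∀ t, 1 ≤ t → ∀ᵐ ω ∂P, ‖X t ω‖ ≤ B) {μ : EuclideanSpace ℝ (Fin d)}
    (hμ : ∀ t, 1 ≤ t → P[X t | obsFiltration X hX (t - 1)] =ᵐ[P] fun _ => μ)
    {α : ℝ} (hα : α ∈ Set.Ioo (0 : ℝ) 1) {lam : ℕ → Ω → ℝ}
    (hlam : ∀ t, 1 ≤ t → Measurable[obsFiltration X hX (t - 1)] (lam t))
    (hlam01 : ∀ t, 1 ≤ t → ∀ ω, lam t ω ∈ Set.Ioo (0 : ℝ) 1) :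
    1 - α ≤ P.real {ω | ∀ t, 1 ≤ t →
      ‖weightedMean X lam t ω - μ‖ ≤ ebRadius B α X lam t ω} := by
  have hd' : (0 : ℝ) < d := by exact_mod_cast hd
  set c : ℝ := 1 / (2 * B) with hc
  have hcB : |c| * (2 * B) ≤ 1 := by
    rw [abs_of_pos (by positivity), hc, one_div_mul_cancel (by positivity)]
  have hsuper : Supermartingale (mixProcess X lam μ c) (obsFiltration X hX) P :=
    (supermartingale_finset_sum Finset.univ fun j _ =>
      (supermartingale_coordProcess hX hB.le hXB hμ hlam hlam01 hcB j).add
        (supermartingale_coordProcess hX hB.le hXB hμ hlam hlam01 (by rwa [abs_neg]) j)).smul_nonneg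
      (by positivity)
  have hnonneg : ∀ t ω, 0 ≤ mixProcess X lam μ c t ω := fun t ω => by
    rw [mixProcess_apply]
    exact mul_nonneg (by positivity) (Finset.sum_nonneg fun j _ =>
      (add_pos (expProcess_pos t ω) (expProcess_pos t ω)).le)
  have hzero : mixProcess X lam μ c 0 = fun _ => 1 := by
    ext ω
    rw [mixProcess_apply]
    simp only [coordProcess, expProcess_zero, Finset.sum_const, Finset.card_univ,
      Fintype.card_fin, nsmul_eq_mul]
    field_simp
    norm_num
  have hville := ville_inequality hsuper hnonneg (c := 1 / α) (by have := hα.1; positivity)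
  rw [hzero] at hville
  simp only [integral_const, probReal_univ, smul_eq_mul, mul_one, one_div_one_div] at hville
  set G := {ω | ∀ t, 1 ≤ t → ‖weightedMean X lam t ω - μ‖ ≤ ebRadius B α X lam t ω}
  -- Covering the space and using subadditivity avoids any measurability of `G`.
  have hcover : Set.univ ⊆ G ∪ {ω | ∃ t, 1 / α ≤ mixProcess X lam μ c t ω} := fun ω _ => by
    by_cases hω : ∃ t, 1 / α ≤ mixProcess X lam μ c t ω
    · exact Or.inr hω
    · push Not at hω
      refine Or.inl fun t ht => norm_weightedMean_sub_le hd hB hα ?_ (hω t)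
      exact Finset.sum_pos (fun i hi => (hlam01 i (Finset.mem_Icc.mp hi).1 ω).1)
        (Finset.nonempty_Icc.mpr ht)
  have hone := (measureReal_mono (μ := P) hcover).trans (measureReal_union_le _ _)
  rw [probReal_univ] at hone
  linarith

end Observations

end EmpBern

theorem mainTheorem2 {Ω : Type*} [MeasurableSpace Ω] (P : Measure Ω) [IsProbabilityMeasure P]
    (d : ℕ) (hd : 2 ≤ d)
    (X : ℕ → Ω → EuclideanSpace ℝ (Fin d)) (hX : ∀ t, 1 ≤ t → Measurable (X t))
    (B : ℝ) (hB : 0 < B) (hXB : ∀ t, 1 ≤ t → ∀ᵐ ω ∂P, ‖X t ω‖ ≤ B)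
    (μ : EuclideanSpace ℝ (Fin d))
    (hμ : ∀ t, 1 ≤ t → P[X t | EmpBern.obsFiltration X hX (t - 1)] =ᵐ[P] fun _ => μ)
    (α : ℝ) (hα : α ∈ Set.Ioo (0 : ℝ) 1) :
    -- time-uniform confidence spheres
    (∀ lam : ℕ → Ω → ℝ,
      (∀ t, 1 ≤ t → Measurable[EmpBern.obsFiltration X hX (t - 1)] (lam t)) →
      (∀ t, 1 ≤ t → ∀ ω, lam t ω ∈ Set.Ioo (0 : ℝ) 1) →
      1 - α ≤ P.real {ω | ∀ t, 1 ≤ t →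
        ‖EmpBern.weightedMean X lam t ω - μ‖ ≤ EmpBern.ebRadius B α X lam t ω}) ∧
    -- fixed-time confidence interval: only the first `n` weights matter, and they may depend on `n`
    (∀ n, 1 ≤ n → ∀ lam : ℕ → Ω → ℝ,
      (∀ t, 1 ≤ t → t ≤ n → Measurable[EmpBern.obsFiltration X hX (t - 1)] (lam t)) →
      (∀ t, 1 ≤ t → t ≤ n → ∀ ω, lam t ω ∈ Set.Ioo (0 : ℝ) 1) →
      1 - α ≤ P.real {ω |
        ‖EmpBern.weightedMean X lam n ω - μ‖ ≤ EmpBern.ebRadius B α X lam n ω}) := by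
  have hd0 : 0 < d := by omega
  refine ⟨fun lam hlam hlam01 =>
    EmpBern.one_sub_le_measureReal_forall hd0 hX hB hXB hμ hα hlam hlam01,
    fun n hn lam hlam hlam01 => ?_⟩
  -- Time `n` involves only the first `n` weights; later ones are filled in with a constant in `(0,
  -- 1)` so that the time-uniform bound applies.
  set lam' : ℕ → Ω → ℝ := fun t => if t ≤ n then lam t else fun _ => 1 / 2 with hlam'
  have heq {ω : Ω} : ∀ i ∈ Finset.Icc 1 n, lam' i ω = lam i ω := fun i hi =>
    congrFun (if_pos (Finset.mem_Icc.mp hi).2) ω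
  refine (EmpBern.one_sub_le_measureReal_forall hd0 hX hB hXB hμ hα (lam := lam')
    (fun t ht => ?_) fun t ht ω => ?_).trans (measureReal_mono fun ω hω => ?_)
  · by_cases htn : t ≤ n
    · simpa [hlam', htn] using hlam t ht htn
    · simp [hlam', htn]
  · by_cases htn : t ≤ n
    · simpa [hlam', htn] using hlam01 t ht htn ω
    · simp only [hlam', htn, if_false]
      norm_num
  · have h := hω n hn
    rwa [EmpBern.weightedMean_congr heq, EmpBern.ebRadius_congr heq] at h
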